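/- Let $m\ge 2$ and, for $\beta=(\beta_0,\beta_1)\in\mathbb C^2$, let $f_\beta(x)=(x-\beta_1)^2-\beta_0$, the family of $0$-spheres in $\mathbb C^1$. Let $\mathcal H_{m,1}\subseteq\mathbb C^m$ be the hypothesis variety, that is, the Zariski closure of the set of all $x=(x_1,\dots,x_m)\in\mathbb C^m$ for which there is a $\beta\in\mathbb C^2$ with $f_\beta(x_1)=\dots=f_\beta(x_m)=0$. For $p\in\mathbb C^m$, a critical point of $\mathcal H_{m,1}$ with respect to $p$ is a point $q\in\mathcal H_{m,1}$ such that $p-q$ lies in the normal space of $\mathcal H_{m,1}$ at $q$, the orthogonal complement of the Zariski tangent space at $q$ with respect to the bilinear form $\sum_i u_iv_i$. The Euclidean distance degree $\mathrm{EDdegree}(\mathcal H_{m,1})$ is the number of critical points, on the regular locus of $\mathcal H_{m,1}$, with respect to a generic $p\in\mathbb C^m$ (i.e. any $p$ outside a suitable proper Zariski closed subset). Then $$\mathrm{EDdegree}(\mathcal H_{m,1})=2^{m-1}-1,$$ and if $p\in\mathbb R^m$ is a real configuration, then all critical points of $\mathcal H_{m,1}$ with respect to $p$ are real. -/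

import Mathlib

noncomputable section

namespace AlgFit

open MvPolynomial

section Varieties

variable {σ : Type*} [Fintype σ]

/-- The Zariski closure of a subset of `ℂ^σ`: the common zeros of all polynomials vanishing
on it. -/
def zariskiClosure (S : Set (σ → ℂ)) : Set (σ → ℂ) :=
  zeroLocus ℂ (vanishingIdeal ℂ S)

/-- The Zariski tangent space of `V` at `q`: the kernel of the Jacobian matrix at `q` of the
radical ideal `I(V)`. -/
def tangentSpace (V : Set (σ → ℂ)) (q : σ → ℂ) : Submodule ℂ (σ → ℂ) where
  carrier := {v | ∀ f ∈ vanishingIdeal ℂ V, ∑ i, eval q (pderiv i f) * v i = 0}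
  add_mem' := by
    intro a b ha hb f hf
    have h1 := ha f hf
    have h2 := hb f hf
    simp only [Pi.add_apply, mul_add, Finset.sum_add_distrib, h1, h2, add_zero]
  zero_mem' := by
    intro f _
    simp
  smul_mem' := by
    intro c a ha f hf
    have h1 := ha f hf
    simp only [Pi.smul_apply, smul_eq_mul, mul_left_comm _ c, ← Finset.mul_sum, h1, mul_zero]

/-- The normal space of `V` at `q`: the orthogonal complement of the tangent space with respect
to the complex bilinear form `∑ i, w i * v i` (no conjugation). -/
def normalSpace (V : Set (σ → ℂ)) (q : σ → ℂ) : Submodule ℂ (σ → ℂ) where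
  carrier := {w | ∀ v ∈ tangentSpace V q, ∑ i, w i * v i = 0}
  add_mem' := by
    intro a b ha hb v hv
    have h1 := ha v hv
    have h2 := hb v hv
    simp only [Pi.add_apply, add_mul, Finset.sum_add_distrib, h1, h2, add_zero]
  zero_mem' := by
    intro v _
    simp
  smul_mem' := by
    intro c a ha v hv
    have h1 := ha v hv
    simp only [Pi.smul_apply, smul_eq_mul, mul_assoc, ← Finset.mul_sum, h1, mul_zero]

/-- `q` is a regular (nonsingular) point of the (equidimensional) variety `V`: the tangent space
has the dimension of `V`, i.e. the Jacobian matrix of `I(V)` has rank `codim V` at `q`. The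
dimension of `V` is the Krull dimension of its coordinate ring. -/
def IsRegularPoint (V : Set (σ → ℂ)) (q : σ → ℂ) : Prop :=
  q ∈ V ∧ ((Module.finrank ℂ (tangentSpace V q) : ℕ) : WithBot ℕ∞) =
    ringKrullDim (MvPolynomial σ ℂ ⧸ vanishingIdeal ℂ V)

/-- `q` is a critical point of the Euclidean distance function with respect to `p` and `V`:
`q` lies on `V`, and `p - q` lies in the normal space of `V` at `q`. -/
def IsCriticalPoint (V : Set (σ → ℂ)) (p q : σ → ℂ) : Prop :=
  q ∈ V ∧ p - q ∈ normalSpace V q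

/-- The Euclidean distance degree of `V` is `d`: for generic `p` (outside of the zero set of a
nonzero polynomial) there are exactly `d` critical points with respect to `p` on the regular
locus of `V`. -/
def HasEDDegree (V : Set (σ → ℂ)) (d : ℕ) : Prop :=
  ∃ g : MvPolynomial σ ℂ, g ≠ 0 ∧ ∀ p : σ → ℂ, eval p g ≠ 0 →
    {q : σ → ℂ | IsRegularPoint V q ∧ IsCriticalPoint V p q}.encard = d

/-- A variety has at most one ED degree. -/
theorem HasEDDegree.unique {V : Set (σ → ℂ)} {d e : ℕ} (hd : HasEDDegree V d)
    (he : HasEDDegree V e) : d = e := by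
  obtain ⟨g, hg, h1⟩ := hd
  obtain ⟨k, hk, h2⟩ := he
  have hne : g * k ≠ 0 := mul_ne_zero hg hk
  obtain ⟨p, hp⟩ : ∃ p : σ → ℂ, eval p (g * k) ≠ 0 := by
    by_contra! hcon
    exact hne (MvPolynomial.funext fun p => by simpa using hcon p)
  rw [map_mul] at hp
  have h3 := h1 p (left_ne_zero_of_mul hp)
  rw [h2 p (right_ne_zero_of_mul hp)] at h3
  exact_mod_cast h3.symm

end Varieties

section Hypothesis

/-- The value `f_β(y)` of a polynomial in `n` variables whose coefficients are polynomials in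
the parameters `β`. -/
def evalFamily {n k : ℕ} (f : MvPolynomial (Fin n) (MvPolynomial (Fin k) ℂ))
    (β : Fin k → ℂ) (y : Fin n → ℂ) : ℂ :=
  eval y (map (eval β) f)

/-- The incidence variety `C_{m,n}` of a system `f = (f 1, …, f r)`: pairs of a configuration `x`
of `m` points in `ℂ^n` (the point `x_i` has coordinates `x (i, j)`) and a parameter `β`, such
that all points of `x` lie on the zero locus of `f_β`. -/
def incidenceVariety {n k r : ℕ} (f : Fin r → MvPolynomial (Fin n) (MvPolynomial (Fin k) ℂ))
    (m : ℕ) : Set ((Fin m × Fin n → ℂ) × (Fin k → ℂ)) :=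
  {z | ∀ (i : Fin m) (l : Fin r), evalFamily (f l) z.2 (fun j => z.1 (i, j)) = 0}

/-- The hypothesis variety `H_{m,n}`: the Zariski closure of the projection of the incidence
variety to the space of configurations. -/
def hypothesisVariety {n k r : ℕ}
    (f : Fin r → MvPolynomial (Fin n) (MvPolynomial (Fin k) ℂ)) (m : ℕ) :
    Set (Fin m × Fin n → ℂ) :=
  zariskiClosure (Prod.fst '' incidenceVariety f m)

/-- The class of `(n-1)`-spheres in `ℂ^n`: the single polynomial
`∑ j, (x_j - β_j)^2 - β_0` with parameters `β_0, …, β_n`. -/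
def sphereFamily (n : ℕ) :
    Fin 1 → MvPolynomial (Fin n) (MvPolynomial (Fin (n + 1)) ℂ) :=
  fun _ => ∑ j : Fin n, (X j - C (X j.succ)) ^ 2 - C (X 0)

end Hypothesis

end AlgFit

end

/-! A quadric in one variable has at most two roots, so the configurations lying on a `0`-sphere are
the vectors with at most two distinct coordinates: a union of planes, one per partition of the
indices into two nonempty blocks (`fst_image_incidenceVariety`). The cubics `tripleCubic` cut it
out, so it is already Zariski closed. At a nonconstant point the tangent space is the plane itself
(`tangentSpace_eq_splitPlane`), and at every point it contains each plane through that point.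
Criticality thus forces `q` to be the orthogonal projection of `p` to a plane, i.e. a vector of
block means (`eq_blockMean_iff`), which is real when `p` is. For generic `p` the two means differ
for every partition, so all projections are regular and distinct. -/

open MvPolynomial Finset

/-! ### Dimension of a finite union. -/

section KrullDimension

/-- A prime containing a finite intersection of ideals contains one of them, so the dimension of
the quotient by the intersection is bounded by the dimensions of the quotients. -/
theorem ringKrullDim_quotient_finset_inf_le {R ι : Type*} [CommRing R] (s : Finset ι)
    (f : ι → Ideal R) (d : WithBot ℕ∞) (h : ∀ i ∈ s, ringKrullDim (R ⧸ f i) ≤ d) :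
    ringKrullDim (R ⧸ s.inf f) ≤ d := by
  rw [ringKrullDim_quotient]
  refine iSup_le fun c => ?_
  have hhead : s.inf f ≤ c.head.1.asIdeal := fun x hx => c.head.2 hx
  obtain ⟨i, hi, hle⟩ := (Ideal.IsPrime.inf_le' c.head.1.isPrime).mp hhead
  have hmem : ∀ k, (c k).1 ∈ PrimeSpectrum.zeroLocus (f i : Set R) := fun k x hx =>
    (LTSeries.head_le c k : c.head ≤ c k) (hle hx)
  -- The smallest prime of the chain contains some `f i`, so the whole chain lives over `R ⧸ f i`.
  let c' : LTSeries (PrimeSpectrum.zeroLocus (f i : Set R)) :=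
    { length := c.length
      toFun := fun k => ⟨(c k).1, hmem k⟩
      step := fun k => c.step k }
  have h1 := Order.LTSeries.length_le_krullDim c'
  rw [← ringKrullDim_quotient] at h1
  exact h1.trans (h i hi)

end KrullDimension

/-! ### Tangent vectors via restriction to lines. -/

section DirectionalDerivative

variable {σ : Type*} [Fintype σ]

/-- The restriction of a polynomial to the line through `q` with direction `v`. -/
noncomputable def restrictLine (q v : σ → ℂ) : MvPolynomial σ ℂ →ₐ[ℂ] Polynomial ℂ :=
  aeval fun i => Polynomial.C (q i) + Polynomial.X * Polynomial.C (v i)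

omit [Fintype σ] in
theorem eval_restrictLine (q v : σ → ℂ) (s : ℂ) (f : MvPolynomial σ ℂ) :
    (restrictLine q v f).eval s = eval (q + s • v) f := by
  induction f using MvPolynomial.induction_on with
  | C a => simp [restrictLine]
  | add f g hf hg => simp [hf, hg]
  | mul_X f i hf =>
    rw [map_mul, Polynomial.eval_mul, hf, map_mul]
    simp [restrictLine, mul_comm s]

theorem derivative_restrictLine (q v : σ → ℂ) (f : MvPolynomial σ ℂ) :
    (restrictLine q v f).derivative.eval 0 = ∑ i, eval q (pderiv i f) * v i := by
  classical
  induction f using MvPolynomial.induction_on with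
  | C a => simp [restrictLine]
  | add f g hf hg => simp [hf, hg, add_mul, Finset.sum_add_distrib]
  | mul_X f j hf =>
    have h0 : (restrictLine q v f).eval 0 = eval q f := by simp [eval_restrictLine]
    have hX : restrictLine q v (X j) =
        Polynomial.C (q j) + Polynomial.X * Polynomial.C (v j) := by simp [restrictLine]
    have hs : ∀ i, eval q (pderiv i (f * X j)) * v i =
        (if i = j then eval q f * v j else 0) + q j * (eval q (pderiv i f) * v i) := by
      intro i
      by_cases hij : i = j
      · subst hij
        simp
        ring
      · simp [pderiv_X_of_ne (Ne.symm hij), hij]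
        ring
    simp only [hs, Finset.sum_add_distrib, ← Finset.mul_sum, ← hf]
    rw [map_mul, hX, Polynomial.derivative_mul]
    simp [h0]
    ring

end DirectionalDerivative

namespace AlgFit

/-! ### The union of planes and its critical points. -/

section SplitPlanes

variable {σ : Type*} [Fintype σ] [DecidableEq σ]

/-- The block of `i` in the partition of `σ` into `t` and its complement. -/
def side (t : Finset σ) (i : σ) : Fin 2 := if i ∈ t then 0 else 1

/-- The vectors constant on `t` and on its complement. -/
def splitPlane (t : Finset σ) : Submodule ℂ (σ → ℂ) :=
  LinearMap.range (LinearMap.funLeft ℂ ℂ (side t))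

omit [Fintype σ] in
theorem mem_splitPlane_iff {t : Finset σ} {x : σ → ℂ} :
    x ∈ splitPlane t ↔ ∃ a b : ℂ, x = fun i => if i ∈ t then a else b := by
  constructor
  · rintro ⟨y, rfl⟩
    refine ⟨y 0, y 1, ?_⟩
    ext i
    by_cases h : i ∈ t <;> simp [LinearMap.funLeft_apply, side, h]
  · rintro ⟨a, b, rfl⟩
    refine ⟨![a, b], ?_⟩
    ext i
    by_cases h : i ∈ t <;> simp [LinearMap.funLeft_apply, side, h]

/-- The blocks avoiding `o` of the partitions of `σ` into two nonempty blocks. -/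
def splits (o : σ) : Finset (Finset σ) := (univ.erase o).powerset.erase ∅

theorem mem_splits {o : σ} {t : Finset σ} : t ∈ splits o ↔ t.Nonempty ∧ o ∉ t := by
  simp [splits, Finset.nonempty_iff_ne_empty, Finset.subset_erase]

/-- Taking the block that avoids `o` counts each unordered partition once; the `- 1` discards the
empty block. -/
theorem card_splits (o : σ) : (splits o).card = 2 ^ (Fintype.card σ - 1) - 1 := by
  rw [splits, card_erase_of_mem (by simp), card_powerset, card_erase_of_mem (mem_univ o),
    card_univ]

theorem side_surjective {o : σ} {t : Finset σ} (ht : t ∈ splits o) :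
    Function.Surjective (side t) := by
  obtain ⟨⟨k, hk⟩, ho⟩ := mem_splits.mp ht
  intro c
  fin_cases c
  · exact ⟨k, by simp [side, hk]⟩
  · exact ⟨o, by simp [side, ho]⟩

theorem finrank_splitPlane {o : σ} {t : Finset σ} (ht : t ∈ splits o) :
    Module.finrank ℂ (splitPlane t) = 2 := by
  rw [splitPlane, LinearMap.finrank_range_of_inj
    (LinearMap.funLeft_injective_of_surjective _ _ _ (side_surjective ht))]
  simp

-- Parametrizing the plane by `Fin 2 → ℂ` turns restriction of polynomials into `rename`, which
-- presents the coordinate ring as a polynomial ring in two variables.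
omit [Fintype σ] in
theorem vanishingIdeal_splitPlane (t : Finset σ) :
    vanishingIdeal ℂ (splitPlane t : Set (σ → ℂ)) =
      RingHom.ker (rename (R := ℂ) (side t)).toRingHom := by
  ext f
  rw [mem_vanishingIdeal_iff, RingHom.mem_ker]
  constructor
  · intro h
    refine MvPolynomial.funext fun y => ?_
    have := h _ ⟨y, rfl⟩
    simpa [eval_rename, MvPolynomial.aeval_eq_eval, LinearMap.funLeft] using this
  · rintro h _ ⟨y, rfl⟩
    have h2 : eval y (rename (side t) f) = 0 := by
      rw [show rename (side t) f = 0 from h, map_zero]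
    simpa [eval_rename, MvPolynomial.aeval_eq_eval, LinearMap.funLeft] using h2

theorem ringKrullDim_splitPlane {o : σ} {t : Finset σ} (ht : t ∈ splits o) :
    ringKrullDim (MvPolynomial σ ℂ ⧸ vanishingIdeal ℂ (splitPlane t : Set (σ → ℂ))) = 2 := by
  have hs : Function.Surjective (rename (R := ℂ) (side t)).toRingHom :=
    rename_surjective _ (side_surjective ht)
  rw [vanishingIdeal_splitPlane,
    ringKrullDim_eq_of_ringEquiv (RingHom.quotientKerEquivOfSurjective hs)]
  simp

/-- The vectors with at most two distinct coordinates, as a union of planes. -/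
def splitVariety (o : σ) : Set (σ → ℂ) := ⋃ t ∈ splits o, (splitPlane t : Set (σ → ℂ))

theorem mem_splitVariety {o : σ} {x : σ → ℂ} :
    x ∈ splitVariety o ↔ ∃ t ∈ splits o, x ∈ splitPlane t := by
  simp [splitVariety]

theorem vanishingIdeal_splitVariety (o : σ) :
    vanishingIdeal ℂ (splitVariety o) =
      (splits o).inf fun t => vanishingIdeal ℂ (splitPlane t : Set (σ → ℂ)) := by
  ext f
  simp only [Submodule.mem_finsetInf, mem_vanishingIdeal_iff, mem_splitVariety, SetLike.mem_coe]
  exact ⟨fun h t ht x hx => h x ⟨t, ht, hx⟩, fun h x ⟨t, ht, hx⟩ => h t ht x hx⟩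

theorem ringKrullDim_splitVariety {o : σ} (h : (splits o).Nonempty) :
    ringKrullDim (MvPolynomial σ ℂ ⧸ vanishingIdeal ℂ (splitVariety o)) = 2 := by
  apply le_antisymm
  · rw [vanishingIdeal_splitVariety]
    exact ringKrullDim_quotient_finset_inf_le _ _ _ fun t ht => (ringKrullDim_splitPlane ht).le
  · obtain ⟨t, ht⟩ := h
    rw [← ringKrullDim_splitPlane ht]
    have hle : vanishingIdeal ℂ (splitVariety o) ≤
        vanishingIdeal ℂ (splitPlane t : Set (σ → ℂ)) :=
      vanishingIdeal_anti_mono fun x hx => mem_splitVariety.mpr ⟨t, ht, hx⟩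
    exact ringKrullDim_le_of_surjective (Ideal.Quotient.factor hle)
      (Ideal.Quotient.factor_surjective hle)

/-- The cubic that vanishes when two of the coordinates `i`, `j`, `k` agree. -/
noncomputable def tripleCubic (i j k : σ) : MvPolynomial σ ℂ := (X i - X j) * (X j - X k) * (X i - X k)

theorem tripleCubic_mem (o i j k : σ) : tripleCubic i j k ∈ vanishingIdeal ℂ (splitVariety o) := by
  rw [mem_vanishingIdeal_iff]
  intro x hx
  obtain ⟨t, -, hx⟩ := mem_splitVariety.mp hx
  obtain ⟨a, b, rfl⟩ := mem_splitPlane_iff.mp hx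
  simp only [tripleCubic, map_mul, map_sub, aeval_X]
  by_cases hi : i ∈ t <;> by_cases hj : j ∈ t <;> by_cases hk : k ∈ t <;> simp [hi, hj, hk]

theorem mem_splitVariety_of_tripleCubic {o : σ} (h : (splits o).Nonempty) {x : σ → ℂ}
    (hx : ∀ i j k, eval x (tripleCubic i j k) = 0) : x ∈ splitVariety o := by
  rw [mem_splitVariety]
  by_cases hc : ∃ j, x j ≠ x o
  · obtain ⟨j, hj⟩ := hc
    refine ⟨univ.filter fun i => x i = x j, mem_splits.mpr ⟨⟨j, by simp⟩, by simpa using hj.symm⟩,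
      mem_splitPlane_iff.mpr ⟨x j, x o, ?_⟩⟩
    ext i
    by_cases hi : x i = x j
    · simp [hi]
    · have := hx i j o
      simp only [tripleCubic, map_mul, map_sub, eval_X, mul_eq_zero, sub_eq_zero, hi, hj,
        false_or] at this
      simpa [hi] using this
  -- A constant vector lies in every plane, so any split serves.
  · push Not at hc
    obtain ⟨t, ht⟩ := h
    refine ⟨t, ht, mem_splitPlane_iff.mpr ⟨x o, x o, ?_⟩⟩
    ext i
    simpa using hc i

theorem zariskiClosure_splitVariety {o : σ} (h : (splits o).Nonempty) :
    zariskiClosure (splitVariety o) = splitVariety o := by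
  apply Set.Subset.antisymm
  · intro x hx
    refine mem_splitVariety_of_tripleCubic h fun i j k => ?_
    have := hx _ (tripleCubic_mem o i j k)
    simpa [MvPolynomial.aeval_eq_eval] using this
  · exact zeroLocus_vanishingIdeal_le _

-- Only the term differentiating the vanishing factor `X i - X j` survives.
omit [DecidableEq σ] in
theorem sum_pderiv_tripleCubic (q v : σ → ℂ) (i j k : σ) (hq : q i = q j) :
    ∑ l, eval q (pderiv l (tripleCubic i j k)) * v l =
      (v i - v j) * (q j - q k) ^ 2 := by
  rw [← derivative_restrictLine]
  simp [tripleCubic, restrictLine, Polynomial.derivative_mul, hq]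
  ring

/-- The line through `q` in a direction of the plane stays in the plane, so `f` vanishes along it.
Constant, possibly singular, `q` are included. -/
theorem splitPlane_le_tangentSpace {o : σ} {t : Finset σ} (ht : t ∈ splits o) {q : σ → ℂ}
    (hq : q ∈ splitPlane t) : splitPlane t ≤ tangentSpace (splitVariety o) q := by
  intro v hv f hf
  rw [← derivative_restrictLine]
  have h0 : restrictLine q v f = 0 := by
    refine Polynomial.funext fun s => ?_
    rw [eval_restrictLine]
    have := (mem_vanishingIdeal_iff.mp hf) (q + s • v) (mem_splitVariety.mpr
      ⟨t, ht, add_mem hq (Submodule.smul_mem _ s hv)⟩)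
    simpa [MvPolynomial.aeval_eq_eval] using this
  simp [h0]

theorem tangentSpace_eq_splitPlane {o : σ} {t : Finset σ} (ht : t ∈ splits o) {a b : ℂ}
    (hab : a ≠ b) :
    tangentSpace (splitVariety o) (fun i => if i ∈ t then a else b) = splitPlane t := by
  refine le_antisymm (fun v hv => ?_)
    (splitPlane_le_tangentSpace ht (mem_splitPlane_iff.mpr ⟨a, b, rfl⟩))
  obtain ⟨⟨k, hk⟩, ho⟩ := mem_splits.mp ht
  refine mem_splitPlane_iff.mpr ⟨v k, v o, ?_⟩
  ext i
  -- The cubic on two indices of one block and one of the other forces `v` to agree on the first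
  -- two, because `a ≠ b`.
  by_cases hi : i ∈ t
  · have := hv _ (tripleCubic_mem o i k o)
    rw [sum_pderiv_tripleCubic _ _ _ _ _ (by simp [hi, hk])] at this
    simpa [hk, ho, sub_eq_zero, hab, hi] using this
  · have := hv _ (tripleCubic_mem o i o k)
    rw [sum_pderiv_tripleCubic _ _ _ _ _ (by simp [hi, ho])] at this
    simpa [hk, ho, sub_eq_zero, hab.symm, hi] using this

/-- The vector obtained from `p` by averaging over `t` and over its complement. -/
def blockMean {K : Type*} [Field K] (t : Finset σ) (p : σ → K) (i : σ) : K :=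
  if i ∈ t then (∑ j ∈ t, p j) / (#t : K) else (∑ j ∈ tᶜ, p j) / (#tᶜ : K)

theorem sum_sub_mul_ite (t : Finset σ) (p : σ → ℂ) (a b c d : ℂ) :
    ∑ i, (p - fun i => if i ∈ t then a else b) i * (if i ∈ t then c else d) =
      ((∑ i ∈ t, p i) - #t * a) * c + ((∑ i ∈ tᶜ, p i) - #tᶜ * b) * d := by
  rw [← Finset.sum_add_sum_compl t]
  congr 1
  · rw [Finset.sum_congr rfl (g := fun i => (p i - a) * c) fun i hi => by simp [hi],
      ← Finset.sum_mul]
    simp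
  · rw [Finset.sum_congr rfl (g := fun i => (p i - b) * d) fun i hi => by
      simp [Finset.mem_compl.mp hi], ← Finset.sum_mul]
    simp

theorem card_ne_zero_of_mem_splits {o : σ} {t : Finset σ} (ht : t ∈ splits o) :
    (#t : ℂ) ≠ 0 ∧ (#tᶜ : ℂ) ≠ 0 := by
  obtain ⟨hn, ho⟩ := mem_splits.mp ht
  exact ⟨Nat.cast_ne_zero.mpr hn.card_pos.ne',
    Nat.cast_ne_zero.mpr (Finset.card_pos.mpr ⟨o, by simpa using ho⟩).ne'⟩

/-- The block mean is the orthogonal projection onto the plane. -/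
theorem eq_blockMean_iff {o : σ} {t : Finset σ} (ht : t ∈ splits o) {p q : σ → ℂ}
    (hq : q ∈ splitPlane t) :
    q = blockMean t p ↔ ∀ v ∈ splitPlane t, ∑ i, (p - q) i * v i = 0 := by
  obtain ⟨h1, h2⟩ := card_ne_zero_of_mem_splits ht
  constructor
  · rintro rfl v hv
    obtain ⟨c, d, rfl⟩ := mem_splitPlane_iff.mp hv
    refine (sum_sub_mul_ite t p _ _ c d).trans ?_
    rw [mul_div_cancel₀ _ h1, mul_div_cancel₀ _ h2]
    simp
  · intro h
    obtain ⟨a, b, rfl⟩ := mem_splitPlane_iff.mp hq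
    -- The indicators of the two blocks isolate the two means.
    have e1 := h _ (mem_splitPlane_iff.mpr ⟨1, 0, rfl⟩)
    have e2 := h _ (mem_splitPlane_iff.mpr ⟨0, 1, rfl⟩)
    rw [sum_sub_mul_ite] at e1 e2
    have ha : a = (∑ i ∈ t, p i) / #t := by
      rw [eq_div_iff h1]
      linear_combination -e1
    have hb : b = (∑ i ∈ tᶜ, p i) / #tᶜ := by
      rw [eq_div_iff h2]
      linear_combination -e2
    ext i
    rw [blockMean, ha, hb]

theorem blockMean_mem (t : Finset σ) (p : σ → ℂ) : blockMean t p ∈ splitPlane t :=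
  mem_splitPlane_iff.mpr ⟨_, _, rfl⟩

theorem IsCriticalPoint.exists_eq_blockMean {o : σ} {p q : σ → ℂ}
    (h : IsCriticalPoint (splitVariety o) p q) : ∃ t ∈ splits o, q = blockMean t p := by
  obtain ⟨t, ht, hq⟩ := mem_splitVariety.mp h.1
  exact ⟨t, ht, (eq_blockMean_iff ht hq).mpr fun v hv =>
    h.2 v (splitPlane_le_tangentSpace ht hq hv)⟩

/-- The difference of the means over `t` and over its complement, as a linear form. -/
noncomputable def meanDifference (t : Finset σ) : MvPolynomial σ ℂ :=
  C (#t : ℂ)⁻¹ * ∑ i ∈ t, X i - C (#tᶜ : ℂ)⁻¹ * ∑ i ∈ tᶜ, X i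

theorem eval_meanDifference (t : Finset σ) (p : σ → ℂ) :
    eval p (meanDifference t) =
      (∑ i ∈ t, p i) / (#t : ℂ) - (∑ i ∈ tᶜ, p i) / (#tᶜ : ℂ) := by
  simp [meanDifference, div_eq_inv_mul]

theorem meanDifference_ne_zero {o : σ} {t : Finset σ} (ht : t ∈ splits o) :
    meanDifference t ≠ 0 := by
  intro h
  -- At the indicator of `t` the means are `1` and `0`.
  have h1 := eval_meanDifference t fun i => if i ∈ t then 1 else 0
  rw [Finset.sum_congr rfl (g := fun _ => (1 : ℂ)) fun i hi => by simp [hi],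
    Finset.sum_congr (s₁ := tᶜ) rfl (g := fun _ => (0 : ℂ)) fun i hi => by
      simp [Finset.mem_compl.mp hi], h] at h1
  simp [(card_ne_zero_of_mem_splits ht).1] at h1

theorem regular_critical_blockMean {o : σ} {t : Finset σ} (ht : t ∈ splits o) {p : σ → ℂ}
    (hp : eval p (meanDifference t) ≠ 0) :
    IsRegularPoint (splitVariety o) (blockMean t p) ∧
      IsCriticalPoint (splitVariety o) p (blockMean t p) := by
  have hT : tangentSpace (splitVariety o) (blockMean t p) = splitPlane t :=
    tangentSpace_eq_splitPlane ht (by rwa [eval_meanDifference, sub_ne_zero] at hp)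
  have hmem : blockMean t p ∈ splitVariety o := mem_splitVariety.mpr ⟨t, ht, blockMean_mem t p⟩
  refine ⟨⟨hmem, ?_⟩, hmem, fun v hv => ?_⟩
  · rw [hT, finrank_splitPlane ht, ringKrullDim_splitVariety ⟨t, ht⟩]
    rfl
  · rw [hT] at hv
    exact (eq_blockMean_iff ht (blockMean_mem t p)).mp rfl v hv

/-- The block `t` is recovered as the set of coordinates whose value differs from that at `o`. -/
theorem blockMean_injOn {o : σ} {p : σ → ℂ}
    (hp : ∀ t ∈ splits o, eval p (meanDifference t) ≠ 0) :
    Set.InjOn (fun t => blockMean t p) (splits o : Set (Finset σ)) := by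
  have key : ∀ t ∈ splits o, ∀ i, i ∈ t ↔ blockMean t p i ≠ blockMean t p o := by
    intro t ht i
    have h := hp t ht
    rw [eval_meanDifference, sub_ne_zero] at h
    have ho := (mem_splits.mp ht).2
    by_cases hi : i ∈ t <;> simp [blockMean, hi, ho, h]
  intro s hs t ht hst
  ext i
  rw [key s hs, key t ht, show blockMean s p = blockMean t p from hst]

theorem hasEDDegree_splitVariety (o : σ) : HasEDDegree (splitVariety o) #(splits o) := by
  refine ⟨∏ t ∈ splits o, meanDifference t,
    Finset.prod_ne_zero_iff.mpr fun t ht => meanDifference_ne_zero ht, fun p hp => ?_⟩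
  rw [map_prod, Finset.prod_ne_zero_iff] at hp
  have himg : {q : σ → ℂ | IsRegularPoint (splitVariety o) q ∧
      IsCriticalPoint (splitVariety o) p q} =
      (fun t => blockMean t p) '' (splits o : Set (Finset σ)) := by
    ext q
    constructor
    · rintro ⟨-, hq⟩
      obtain ⟨t, ht, rfl⟩ := hq.exists_eq_blockMean
      exact ⟨t, ht, rfl⟩
    · rintro ⟨t, ht, rfl⟩
      exact regular_critical_blockMean ht (hp t ht)
  rw [himg, (blockMean_injOn hp).encard_image, Set.encard_coe_eq_coe_finsetCard]

theorem blockMean_ofReal (t : Finset σ) (p : σ → ℝ) :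
    blockMean t (fun i => (p i : ℂ)) = fun i => ((blockMean t p i : ℝ) : ℂ) := by
  ext i
  by_cases hi : i ∈ t <;> simp [blockMean, hi]

end SplitPlanes

/-! ### Identification with the hypothesis variety. -/

theorem evalFamily_sphereFamily_one (β : Fin 2 → ℂ) (y : Fin 1 → ℂ) (l : Fin 1) :
    evalFamily (sphereFamily 1 l) β y = (y 0 - β 1) ^ 2 - β 0 := by
  simp [evalFamily, sphereFamily]

theorem fst_image_incidenceVariety {m : ℕ} {o : Fin m × Fin 1} (h : (splits o).Nonempty) :
    Prod.fst '' incidenceVariety (sphereFamily 1) m = splitVariety o := by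
  ext x
  constructor
  · rintro ⟨⟨x, β⟩, hx, rfl⟩
    have hx' : ∀ i, (x i - β 1) ^ 2 = β 0 := by
      rintro ⟨i, j⟩
      have := hx i 0
      rw [evalFamily_sphereFamily_one, sub_eq_zero] at this
      rwa [Subsingleton.elim j 0]
    refine mem_splitVariety_of_tripleCubic h fun i j k => ?_
    simp only [tripleCubic, map_mul, map_sub, eval_X]
    rcases sq_eq_sq_iff_eq_or_eq_neg.mp ((hx' i).trans (hx' j).symm) with hij | hij
    · linear_combination (x j - x k) * (x i - x k) * hij
    rcases sq_eq_sq_iff_eq_or_eq_neg.mp ((hx' j).trans (hx' k).symm) with hjk | hjk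
    · linear_combination (x i - x j) * (x i - x k) * hjk
    -- Two reflections in the centre `β 1` cancel, giving `x i = x k`.
    · linear_combination (x i - x j) * (x j - x k) * (hij - hjk)
  · intro hx
    obtain ⟨t, -, hx⟩ := mem_splitVariety.mp hx
    obtain ⟨a, b, rfl⟩ := mem_splitPlane_iff.mp hx
    have hsq : ∀ i, ((if i ∈ t then a else b) - (a + b) / 2) ^ 2 = ((a - b) / 2) ^ 2 := by
      intro i
      split_ifs <;> ring
    -- The sphere through `a` and `b`: squared radius, then midpoint.
    refine ⟨(_, ![((a - b) / 2) ^ 2, (a + b) / 2]), fun i l => ?_, rfl⟩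
    exact (evalFamily_sphereFamily_one _ _ _).trans (sub_eq_zero.mpr (hsq (i, 0)))

theorem hypothesisVariety_sphereFamily_one {m : ℕ} {o : Fin m × Fin 1}
    (h : (splits o).Nonempty) : hypothesisVariety (sphereFamily 1) m = splitVariety o := by
  rw [hypothesisVariety, fst_image_incidenceVariety h, zariskiClosure_splitVariety h]

end AlgFit

open AlgFit in
theorem exists_splits_nonempty {m : ℕ} (hm : 2 ≤ m) :
    ∃ o : Fin m × Fin 1, (splits o).Nonempty :=
  ⟨(⟨0, by omega⟩, 0), {(⟨1, by omega⟩, 0)}, 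
    mem_splits.mpr ⟨singleton_nonempty _, by simp [Prod.ext_iff, Fin.ext_iff]⟩⟩

theorem theorem1 (m : ℕ) (hm : 2 ≤ m) :
    AlgFit.HasEDDegree (AlgFit.hypothesisVariety (AlgFit.sphereFamily 1) m) (2 ^ (m - 1) - 1) ∧
      ∀ (p : Fin m × Fin 1 → ℝ) (q : Fin m × Fin 1 → ℂ),
        AlgFit.IsCriticalPoint (AlgFit.hypothesisVariety (AlgFit.sphereFamily 1) m)
          (fun i => (p i : ℂ)) q →
        ∃ x : Fin m × Fin 1 → ℝ, q = fun i => (x i : ℂ) := by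
  obtain ⟨o, ho⟩ := exists_splits_nonempty hm
  rw [AlgFit.hypothesisVariety_sphereFamily_one ho]
  constructor
  · have hd := AlgFit.hasEDDegree_splitVariety o
    rw [AlgFit.card_splits] at hd
    simpa using hd
  · intro p q hq
    obtain ⟨t, -, rfl⟩ := hq.exists_eq_blockMean
    exact ⟨AlgFit.blockMean t p, AlgFit.blockMean_ofReal t p⟩
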